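/- There are infinitely many elliptic curves $E/\mathbb{Q}$, pairwise non-isomorphic over $\mathbb{Q}$, such that for each of them there exists a cubic field $K$ (a number field with $[K:\mathbb{Q}]=3$, which may depend on $E$) for which the group $E(K)$ contains a point of order $13$. -/

import Mathlib

open Classical in
/-- There is a cubic field `K` (a number field of degree 3 over `ℚ`) such that the group `E(K)` of
`K`-rational points of `E` has an element of order exactly `n`. (Every cubic field is isomorphic to one in `Type`.) -/
def HasPointOfOrderOverCubicField (E : WeierstrassCurve ℚ) (n : ℕ) : Prop :=
  ∃ (K : Type) (_ : Field K) (_ : NumberField K), Module.finrank ℚ K = 3 ∧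
    ∃ P : (E.baseChange K).toAffine.Point, addOrderOf P = n

/-- The `ℚ`-isomorphism classes of Weierstrass curves over `ℚ`: two curves are identified when an
admissible change of variables with coefficients in `ℚ` transforms one into the other. For elliptic
curves this is isomorphism over `ℚ`. -/
abbrev RatIsomClass : Type :=
  MulAction.orbitRel.Quotient (WeierstrassCurve.VariableChange ℚ) (WeierstrassCurve ℚ)

/-- The `ℚ`-isomorphism class of a Weierstrass curve over `ℚ`. -/
def ratIsomClass (E : WeierstrassCurve ℚ) : RatIsomClass :=
  Quotient.mk _ E

/-! The modular curve X₁(13) has genus 2, but its quotient by the order 3 subgroup of the diamond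
operators is a projective line, with coordinate `m`. X₁(13) is the cubic cover of this line cut out
by `thirteenCubic`, so a rational `m` at which the cubic is irreducible gives a curve over ℚ with a
13-torsion point over a cubic field.

Concretely, a root `X` of the cubic gives parameters `r`, `s` satisfying the equation of X₁(13)
(`thirteen_relation`), so (0, 0) on `tateCurve r s` is killed by 13. The invariants c₄ and c₆ show
that this curve is isomorphic, over the cubic field, to `thirteenCurve m`, which is defined over ℚ
(`exists_smul_tateCurve_eq`). The cubic is irreducible for every odd `m`, and the j-invariant grows
without bound along the family (`le_j_thirteenCurve`), which yields infinitely many classes. -/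

namespace WeierstrassCurve
namespace Affine

/-! ### Admissible changes of variables as group homomorphisms on points. -/

section VariableChange

variable {F : Type*} [Field F] (C : VariableChange F) {W : WeierstrassCurve F}

lemma equation_variableChange_smul {x y : F} (h : W.toAffine.Equation x y) :
    (C • W).toAffine.Equation (C.u⁻¹ ^ 2 * (x - C.r))
      (C.u⁻¹ ^ 3 * (y - C.s * (x - C.r) - C.t)) := by
  rw [equation_iff] at h ⊢
  simp only [variableChange_a₁, variableChange_a₂, variableChange_a₃, variableChange_a₄,
    variableChange_a₆]
  linear_combination (↑C.u⁻¹ : F) ^ 6 * h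

lemma variableChange_smul_eq_negY_iff (x y₁ y₂ : F) :
    (↑C.u⁻¹ : F) ^ 3 * (y₁ - C.s * (x - C.r) - C.t) = (C • W).toAffine.negY
      (C.u⁻¹ ^ 2 * (x - C.r)) (C.u⁻¹ ^ 3 * (y₂ - C.s * (x - C.r) - C.t)) ↔
    y₁ = W.toAffine.negY x y₂ := by
  have h : (C • W).toAffine.negY (C.u⁻¹ ^ 2 * (x - C.r)) (C.u⁻¹ ^ 3 * (y₂ - C.s * (x - C.r) - C.t))
      = (↑C.u⁻¹ : F) ^ 3 * (W.toAffine.negY x y₂ - C.s * (x - C.r) - C.t) := by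
    simp only [negY, variableChange_a₁, variableChange_a₃]
    ring
  rw [h, mul_right_inj' (pow_ne_zero 3 C.u⁻¹.ne_zero), sub_left_inj, sub_left_inj]

lemma variableChange_smul_X_eq_iff (x₁ x₂ : F) :
    (↑C.u⁻¹ : F) ^ 2 * (x₁ - C.r) = C.u⁻¹ ^ 2 * (x₂ - C.r) ↔ x₁ = x₂ := by
  rw [mul_right_inj' (pow_ne_zero 2 C.u⁻¹.ne_zero), sub_left_inj]

lemma slope_variableChange_smul [DecidableEq F] {x₁ x₂ y₁ y₂ : F}
    (h₁ : W.toAffine.Equation x₁ y₁) (h₂ : W.toAffine.Equation x₂ y₂)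
    (hxy : ¬(x₁ = x₂ ∧ y₁ = W.toAffine.negY x₂ y₂)) :
    (C • W).toAffine.slope (C.u⁻¹ ^ 2 * (x₁ - C.r)) (C.u⁻¹ ^ 2 * (x₂ - C.r))
      (C.u⁻¹ ^ 3 * (y₁ - C.s * (x₁ - C.r) - C.t)) (C.u⁻¹ ^ 3 * (y₂ - C.s * (x₂ - C.r) - C.t)) =
      C.u⁻¹ * (W.toAffine.slope x₁ x₂ y₁ y₂ - C.s) := by
  have hu : (C.u : F) ≠ 0 := C.u.ne_zero
  by_cases hx : x₁ = x₂
  · subst hx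
    have hy : y₁ ≠ W.toAffine.negY x₁ y₂ := fun h ↦ hxy ⟨rfl, h⟩
    obtain rfl : y₁ = y₂ := Y_eq_of_Y_ne h₁ h₂ rfl hy
    have hy' := (variableChange_smul_eq_negY_iff C (W := W) x₁ y₁ y₁).not.2 hy
    have hℓ : W.toAffine.slope x₁ x₁ y₁ y₁ * (y₁ - W.toAffine.negY x₁ y₁) =
        3 * x₁ ^ 2 + 2 * W.a₂ * x₁ + W.a₄ - W.a₁ * y₁ := by
      rw [slope_of_Y_ne rfl hy, div_mul_cancel₀ _ (sub_ne_zero.2 hy)]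
    rw [slope_of_Y_ne rfl hy', div_eq_iff (sub_ne_zero.2 hy')]
    simp only [negY, variableChange_a₁, variableChange_a₂, variableChange_a₃,
      variableChange_a₄] at hℓ ⊢
    linear_combination (-(↑C.u⁻¹ : F) ^ 4) * hℓ
  · have hx' : x₁ - x₂ ≠ 0 := sub_ne_zero.2 hx
    have hne := (variableChange_smul_X_eq_iff C x₁ x₂).not.2 hx
    rw [slope_of_X_ne hx, slope_of_X_ne hne, div_eq_iff (sub_ne_zero.2 hne)]
    simp only [Units.val_inv_eq_inv_val]
    field_simp
    ring

/-- The group homomorphism from the points of an elliptic curve to the points of its image under an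
admissible change of variables. -/
noncomputable def Point.variableChange [DecidableEq F] [W.IsElliptic] :
    W.toAffine.Point →+ (C • W).toAffine.Point where
  toFun
    | .zero => 0
    | .some _ _ h => .some _ _
        (equation_iff_nonsingular.1 (equation_variableChange_smul C (W := W) h.1))
  map_zero' := rfl
  map_add' := by
    rintro (_ | ⟨x₁, y₁, h₁⟩) (_ | ⟨x₂, y₂, h₂⟩)
    any_goals rfl
    · by_cases hxy : x₁ = x₂ ∧ y₁ = W.toAffine.negY x₂ y₂
      · obtain ⟨rfl, hy⟩ := hxy
        rw [Point.add_of_Y_eq rfl hy]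
        exact (Point.add_of_Y_eq rfl ((variableChange_smul_eq_negY_iff C (W := W) _ _ _).2 hy)).symm
      · have hxy' : ¬((↑C.u⁻¹ : F) ^ 2 * (x₁ - C.r) = C.u⁻¹ ^ 2 * (x₂ - C.r) ∧
            (↑C.u⁻¹ : F) ^ 3 * (y₁ - C.s * (x₁ - C.r) - C.t) = (C • W).toAffine.negY
              (C.u⁻¹ ^ 2 * (x₂ - C.r)) (C.u⁻¹ ^ 3 * (y₂ - C.s * (x₂ - C.r) - C.t))) := by
          rintro ⟨hx, hy⟩
          obtain rfl := (variableChange_smul_X_eq_iff C _ _).1 hx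
          exact hxy ⟨rfl, (variableChange_smul_eq_negY_iff C (W := W) _ _ _).1 hy⟩
        rw [Point.add_some hxy]
        refine Eq.trans ?_ (Point.add_some hxy').symm
        have hs := slope_variableChange_smul C h₁.1 h₂.1 hxy
        rw [Point.some.injEq, hs]
        simp only [addX, addY, negAddY, negY, variableChange_a₁, variableChange_a₂,
          variableChange_a₃]
        constructor <;> ring

lemma Point.variableChange_some_ne_zero [DecidableEq F] [W.IsElliptic] {x y : F}
    (h : W.toAffine.Nonsingular x y) : Point.variableChange C (.some x y h) ≠ 0 :=
  Point.some_ne_zero _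

end VariableChange

/-! ### Addition with a prescribed slope, free of division. -/

section Add

variable {F : Type*} [Field F] [DecidableEq F] {W : WeierstrassCurve.Affine F}

lemma some_add_some_of_line {x₁ x₂ x₃ y₁ y₂ y₃ ℓ : F} (h₁ : W.Nonsingular x₁ y₁)
    (h₂ : W.Nonsingular x₂ y₂) (h₃ : W.Nonsingular x₃ y₃) (hx : x₁ ≠ x₂)
    (hℓ : ℓ * (x₁ - x₂) = y₁ - y₂) (hx₃ : x₃ = W.addX x₁ x₂ ℓ) (hy₃ : y₃ = W.addY x₁ x₂ y₁ ℓ) :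
    Point.some _ _ h₁ + Point.some _ _ h₂ = Point.some _ _ h₃ := by
  have hs : W.slope x₁ x₂ y₁ y₂ = ℓ := by
    rw [slope_of_X_ne hx, ← hℓ, mul_div_cancel_right₀ _ (sub_ne_zero.2 hx)]
  rw [Point.add_of_X_ne hx, Point.some.injEq, hs]
  exact ⟨hx₃.symm, hy₃.symm⟩

lemma some_add_self_of_tangent {x₁ x₃ y₁ y₃ ℓ : F} (h₁ : W.Nonsingular x₁ y₁)
    (h₃ : W.Nonsingular x₃ y₃) (hy : y₁ - W.negY x₁ y₁ ≠ 0)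
    (hℓ : ℓ * (y₁ - W.negY x₁ y₁) = 3 * x₁ ^ 2 + 2 * W.a₂ * x₁ + W.a₄ - W.a₁ * y₁)
    (hx₃ : x₃ = W.addX x₁ x₁ ℓ) (hy₃ : y₃ = W.addY x₁ x₁ y₁ ℓ) :
    Point.some _ _ h₁ + Point.some _ _ h₁ = Point.some _ _ h₃ := by
  have hs : W.slope x₁ x₁ y₁ y₁ = ℓ := by
    rw [slope_of_Y_ne rfl (sub_ne_zero.1 hy), ← hℓ, mul_div_cancel_right₀ _ hy]
  rw [Point.add_self_of_Y_ne (sub_ne_zero.1 hy), Point.some.injEq, hs]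
  exact ⟨hx₃.symm, hy₃.symm⟩

end Add

end Affine
end WeierstrassCurve

/-! ### Tate normal form and the equation of X₁(13). -/

namespace WeierstrassCurve

/-- The elliptic curve `y² + (1 - c)xy - by = x³ - bx²` in Tate normal form with `c = s(r - 1)` and
`b = rc`. -/
def tateCurve {F : Type*} [Field F] (r s : F) : WeierstrassCurve F :=
  ⟨1 - s * (r - 1), -(r * s * (r - 1)), -(r * s * (r - 1)), 0, 0⟩

namespace Affine

variable {F : Type*} [Field F] [DecidableEq F]

/-- The equation of the modular curve `X₁(13)` in the parameters `r` and `s` expresses that the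
origin of the Tate normal form is annihilated by `13`. -/
lemma thirteen_nsmul_eq_zero_of_tateCurve {W : WeierstrassCurve.Affine F} [W.IsElliptic] {r s : F}
    (hr : r ≠ 0) (hs : s ≠ 0) (hr₁ : r - 1 ≠ 0) (hs₁ : s - 1 ≠ 0) (hrs : r - s ≠ 0)
    (h : r ^ 3 - r ^ 2 * s ^ 4 + 5 * r ^ 2 * s ^ 3 - 9 * r ^ 2 * s ^ 2 + 4 * r ^ 2 * s - 2 * r ^ 2
      - r * s ^ 3 + 6 * r * s ^ 2 - 3 * r * s + r - s ^ 3 = 0)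
    (hW : W = tateCurve r s) (h₁ : W.Nonsingular 0 0) :
    13 • Point.some 0 0 h₁ = 0 := by
  obtain ⟨ha₁, ha₂, ha₃, ha₄, ha₆⟩ : W.a₁ = 1 - s * (r - 1) ∧ W.a₂ = -(r * s * (r - 1)) ∧
      W.a₃ = -(r * s * (r - 1)) ∧ W.a₄ = 0 ∧ W.a₆ = 0 := by
    subst hW; exact ⟨rfl, rfl, rfl, rfl, rfl⟩
  clear hW
  obtain ⟨P, hP⟩ : ∃ P, P = Point.some 0 0 h₁ := ⟨_, rfl⟩
  rw [← hP]
  have hs₂ : 1 - s ≠ 0 := by rwa [← neg_ne_zero, neg_sub]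
  have h₂ : W.Nonsingular (r * s * (r - 1)) (r * s * (r - 1) * (s * (r - 1))) :=
    equation_iff_nonsingular.1 <| by
      simp only [equation_iff, ha₁, ha₂, ha₃, ha₄, ha₆]; ring
  have h₃ : W.Nonsingular (s * (r - 1)) (s * (r - 1) ^ 2) :=
    equation_iff_nonsingular.1 <| by
      simp only [equation_iff, ha₁, ha₂, ha₃, ha₄, ha₆]; ring
  have h₄ : W.Nonsingular (r * (r - 1)) (r ^ 2 * (r - 1) * (s - 1)) :=
    equation_iff_nonsingular.1 <| by
      simp only [equation_iff, ha₁, ha₂, ha₃, ha₄, ha₆]; ring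
  -- The slope of the tangent at 3P; the point (x, y) is 6P.
  obtain ⟨ℓ, hℓ⟩ : ∃ ℓ, ℓ = (2 * s - r * s - 1) / (1 - s) := ⟨_, rfl⟩
  obtain ⟨x, hx⟩ : ∃ x, x = s * (r - 1) * (r - s) / (1 - s) ^ 2 := ⟨_, rfl⟩
  obtain ⟨y, hy⟩ : ∃ y, y = -(1 - s * (r - 1)) * x + r * s * (r - 1) - ℓ * (x - s * (r - 1)) -
    s * (r - 1) ^ 2 := ⟨_, rfl⟩
  have h₆ : W.Nonsingular x y :=
    equation_iff_nonsingular.1 <| by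
      simp only [equation_iff, ha₁, ha₂, ha₃, ha₄, ha₆, hy, hx, hℓ]
      field_simp
      ring
  have e₂ : P + P = .some _ _ h₂ := by
    rw [hP]
    refine some_add_self_of_tangent (ℓ := 0) _ _ ?_ ?_ ?_ ?_
    · rw [negY, ha₁, ha₃]
      have : r * s * (r - 1) ≠ 0 := mul_ne_zero (mul_ne_zero hr hs) hr₁
      convert neg_ne_zero.2 this using 1
      ring
    all_goals simp only [negY, addX, addY, negAddY, ha₁, ha₂, ha₃, ha₄]; ring
  have e₃ : Point.some _ _ h₂ + P = .some _ _ h₃ := by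
    rw [hP]
    refine some_add_some_of_line (ℓ := s * (r - 1)) _ _ _ ?_ ?_ ?_ ?_
    · exact mul_ne_zero (mul_ne_zero hr hs) hr₁
    · ring
    all_goals simp only [negY, addX, addY, negAddY, ha₁, ha₂, ha₃]; ring
  have e₄ : Point.some _ _ h₃ + P = .some _ _ h₄ := by
    rw [hP]
    refine some_add_some_of_line (ℓ := r - 1) _ _ _ ?_ ?_ ?_ ?_
    · exact mul_ne_zero hs hr₁
    · ring
    all_goals simp only [negY, addX, addY, negAddY, ha₁, ha₂, ha₃]; ring
  have e₆ : Point.some _ _ h₃ + Point.some _ _ h₃ = .some _ _ h₆ := by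
    refine some_add_self_of_tangent (ℓ := ℓ) _ _ ?_ ?_ ?_ ?_
    · rw [negY, ha₁, ha₃]
      have : s * (r - 1) * (r - 1) * (1 - s) ≠ 0 :=
        mul_ne_zero (mul_ne_zero (mul_ne_zero hs hr₁) hr₁) hs₂
      convert this using 1
      ring
    all_goals
      simp only [negY, addX, addY, negAddY, ha₁, ha₂, ha₃, ha₄, hy, hx, hℓ]
      field_simp
      ring
  -- The only step that uses `h`: 7P = -6P is the equation of X₁(13).
  have e₇ : Point.some _ _ h₃ + Point.some _ _ h₄ = -.some _ _ h₆ := by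
    rw [Point.neg_some]
    have hX : x = W.addX (s * (r - 1)) (r * (r - 1)) ((r ^ 2 * s - r ^ 2 - r * s + s) / (r - s)) := by
      simp only [addX, ha₁, ha₂, hx]
      field_simp
      linear_combination (s * (r - 1)) * h
    refine some_add_some_of_line (ℓ := (r ^ 2 * s - r ^ 2 - r * s + s) / (r - s)) _ _ _ ?_ ?_ hX ?_
    · rw [← sub_ne_zero]
      convert mul_ne_zero hr₁ (neg_ne_zero.2 hrs) using 1
      ring
    · field_simp
      ring
    · simp only [negY, addY, negAddY, ha₁, ha₃]
      rw [← hX, hy, hℓ, hx]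
      field_simp
      linear_combination -h
  -- Grouped as (3P + 4P) + (3P + 3P) = 7P + 6P.
  have : 13 • P = (((P + P) + P) + (((P + P) + P) + P)) + (((P + P) + P) + ((P + P) + P)) := by
    abel
  rw [this, e₂, e₃, e₄, e₆, e₇, neg_add_cancel]

end Affine
end WeierstrassCurve

namespace WeierstrassCurve

/-! ### Descent of the universal curve to the `m`-line. -/

section Parametrization

/-- An elliptic curve with a rational subgroup of order `13` that becomes pointwise rational over a
cyclic cubic extension, given in short Weierstrass form. -/
def thirteenCurve {F : Type*} [Field F] (m : F) : WeierstrassCurve F where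
  a₁ := 0
  a₂ := 0
  a₃ := 0
  a₄ := -((m ^ 4 - m ^ 3 + 5 * m ^ 2 + m + 1) ^ 3 *
    (m ^ 8 - 5 * m ^ 7 + 7 * m ^ 6 - 5 * m ^ 5 + 5 * m ^ 3 + 7 * m ^ 2 + 5 * m + 1)) / 48
  a₆ := (m ^ 4 - m ^ 3 + 5 * m ^ 2 + m + 1) ^ 4 * (m ^ 2 + 1) *
    (m ^ 12 - 8 * m ^ 11 + 25 * m ^ 10 - 44 * m ^ 9 + 40 * m ^ 8 + 18 * m ^ 7 - 40 * m ^ 6 - 18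
      * m ^ 5 + 40 * m ^ 4 + 44 * m ^ 3 + 25 * m ^ 2 + 8 * m + 1) / 864

lemma thirteenCurve_map {F K : Type*} [Field F] [Field K] (f : F →+* K) (m : F) :
    (thirteenCurve m).map f = thirteenCurve (f m) := by
  ext <;> simp [thirteenCurve, map_ofNat]

lemma thirteenCurve_c₄ {F : Type*} [Field F] [CharZero F] (m : F) :
    (thirteenCurve m).c₄ = (m ^ 4 - m ^ 3 + 5 * m ^ 2 + m + 1) ^ 3 *
      (m ^ 8 - 5 * m ^ 7 + 7 * m ^ 6 - 5 * m ^ 5 + 5 * m ^ 3 + 7 * m ^ 2 + 5 * m + 1) := by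
  simp only [c₄, b₂, b₄, thirteenCurve]
  ring

lemma thirteenCurve_Δ {F : Type*} [Field F] [CharZero F] (m : F) :
    (thirteenCurve m).Δ =
      (m ^ 4 - m ^ 3 + 5 * m ^ 2 + m + 1) ^ 8 * m ^ 13 * (m ^ 2 - 3 * m - 1) := by
  simp only [Δ, b₂, b₄, b₆, b₈, thirteenCurve]
  ring

/-- Completing the square and the cube leaves a curve determined by c₄, c₆ and the free scaling `u`.
-/
lemma exists_smul_eq_short {F : Type*} [Field F] [CharZero F] (W : WeierstrassCurve F) {u : F}
    (hu : u ≠ 0) : ∃ C : VariableChange F,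
      C • W = ⟨0, 0, 0, -(u⁻¹ ^ 4 * W.c₄ / 48), -(u⁻¹ ^ 6 * W.c₆ / 864)⟩ := by
  refine ⟨⟨Units.mk0 u hu, -W.b₂ / 12, -W.a₁ / 2, -(W.a₃ - W.b₂ / 12 * W.a₁) / 2⟩, ?_⟩
  ext <;> simp only [variableChange_def, c₄, c₆, b₂, b₄, b₆, Units.val_inv_eq_inv_val,
    Units.val_mk0] <;> ring

variable {F : Type*} [Field F] {m X r s : F}

/-- After substitution the left side is a multiple of the cubic; the certificate is the cofactor. -/
lemma thirteen_relation (h : m * X ^ 3 - (m ^ 2 + m - 1) * X ^ 2 + (m ^ 2 - 2 * m - 1) * X + m = 0)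
    (hr : r = m ^ 2 * X ^ 2 - (m ^ 2 - 2 * m) * X - (m - 1))
    (hs : s = m * X ^ 2 - (m ^ 2 - 1) * X - m) :
    r ^ 3 - r ^ 2 * s ^ 4 + 5 * r ^ 2 * s ^ 3 - 9 * r ^ 2 * s ^ 2 + 4 * r ^ 2 * s - 2 * r ^ 2
      - r * s ^ 3 + 6 * r * s ^ 2 - 3 * r * s + r - s ^ 3 = 0 := by
  subst hr hs
  linear_combination
    (-X ^ 9 * m ^ 7 + 3 * X ^ 8 * m ^ 8 + X ^ 8 * m ^ 7 - 7 * X ^ 8 * m ^ 6 - 3 * X ^ 7 * m ^ 9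
      - 3 * X ^ 7 * m ^ 8 + 20 * X ^ 7 * m ^ 7 + 10 * X ^ 7 * m ^ 6 - 21 * X ^ 7 * m ^ 5 + X ^
      6 * m ^ 10 + 3 * X ^ 6 * m ^ 9 - 19 * X ^ 6 * m ^ 8 - 25 * X ^ 6 * m ^ 7 + 52 * X ^ 6 * m
      ^ 6 + 39 * X ^ 6 * m ^ 5 - 35 * X ^ 6 * m ^ 4 - X ^ 5 * m ^ 10 + 6 * X ^ 5 * m ^ 9 + 20 *
      X ^ 5 * m ^ 8 - 42 * X ^ 5 * m ^ 7 - 84 * X ^ 5 * m ^ 6 + 60 * X ^ 5 * m ^ 5 + 79 * X ^ 5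
      * m ^ 4 - 35 * X ^ 5 * m ^ 3 - 5 * X ^ 4 * m ^ 9 + 11 * X ^ 4 * m ^ 8 + 55 * X ^ 4 * m ^
      7 - 30 * X ^ 4 * m ^ 6 - 140 * X ^ 4 * m ^ 5 + 10 * X ^ 4 * m ^ 4 + 91 * X ^ 4 * m ^ 3 -
      21 * X ^ 4 * m ^ 2 - 10 * X ^ 3 * m ^ 8 + 4 * X ^ 3 * m ^ 7 + 74 * X ^ 3 * m ^ 6 + 25 * X
      ^ 3 * m ^ 5 - 117 * X ^ 3 * m ^ 4 - 47 * X ^ 3 * m ^ 3 + 59 * X ^ 3 * m ^ 2 - 7 * X ^ 3 *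
      m - 10 * X ^ 2 * m ^ 7 - 9 * X ^ 2 * m ^ 6 + 47 * X ^ 2 * m ^ 5 + 53 * X ^ 2 * m ^ 4 - 39
      * X ^ 2 * m ^ 3 - 46 * X ^ 2 * m ^ 2 + 19 * X ^ 2 * m - X ^ 2 - 5 * X * m ^ 6 - 10 * X *
      m ^ 5 + 10 * X * m ^ 4 + 28 * X * m ^ 3 + 3 * X * m ^ 2 - 15 * X * m + 2 * X - m ^ 5 - 3
      * m ^ 4 - m ^ 3 + 4 * m ^ 2 + 3 * m - 1) * h

/-- Up to fourth and sixth powers of `r + m * X`, the invariants depend on `m` alone. Each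
intermediate quantity is first reduced modulo the cubic to degree at most 2 in `X`, which keeps the
certificates small. -/
lemma tateCurve_c₄_c₆ (h : m * X ^ 3 - (m ^ 2 + m - 1) * X ^ 2 + (m ^ 2 - 2 * m - 1) * X + m = 0)
    (hr : r = m ^ 2 * X ^ 2 - (m ^ 2 - 2 * m) * X - (m - 1))
    (hs : s = m * X ^ 2 - (m ^ 2 - 1) * X - m) :
    (m ^ 4 - m ^ 3 + 5 * m ^ 2 + m + 1) * (tateCurve r s).c₄ = (r + m * X) ^ 4 *
      (m ^ 8 - 5 * m ^ 7 + 7 * m ^ 6 - 5 * m ^ 5 + 5 * m ^ 3 + 7 * m ^ 2 + 5 * m + 1) ∧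
    (m ^ 4 - m ^ 3 + 5 * m ^ 2 + m + 1) ^ 2 * (tateCurve r s).c₆ =
      -((r + m * X) ^ 6 * (m ^ 2 + 1) *
        (m ^ 12 - 8 * m ^ 11 + 25 * m ^ 10 - 44 * m ^ 9 + 40 * m ^ 8 + 18 * m ^ 7 - 40 * m ^ 6
          - 18 * m ^ 5 + 40 * m ^ 4 + 44 * m ^ 3 + 25 * m ^ 2 + 8 * m + 1)) := by
  have hc : s * (r - 1) =
      X ^ 2 * m ^ 3 + X ^ 2 * m ^ 2 - X * m ^ 3 + 2 * X * m ^ 2 + X * m - m ^ 2 := by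
    rw [hr, hs]
    linear_combination
      (X * m ^ 2 + 2 * m) * h
  have hb' : r * s * (r - 1) = r * (s * (r - 1)) := by ring
  have hb : r * s * (r - 1) =
      X ^ 2 * m ^ 7 + 4 * X ^ 2 * m ^ 5 + 2 * X ^ 2 * m ^ 4 + 3 * X ^ 2 * m ^ 3 + X ^ 2 * m ^ 2
        - X * m ^ 7 + 2 * X * m ^ 6 - 3 * X * m ^ 5 + 5 * X * m ^ 4 + 2 * X * m ^ 3 + 3 * X * m
        ^ 2 + X * m - m ^ 6 - 3 * m ^ 4 - m ^ 3 - m ^ 2 := by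
    rw [hb', hc, hr]
    linear_combination
      (X * m ^ 4 + X * m ^ 3 + m ^ 5 + 3 * m ^ 3 + 2 * m ^ 2) * h
  have hb₂ : (tateCurve r s).b₂ =
      X ^ 2 * m ^ 8 - 3 * X ^ 2 * m ^ 7 + 5 * X ^ 2 * m ^ 6 - 10 * X ^ 2 * m ^ 5 - 2 * X ^ 2 *
        m ^ 4 - 13 * X ^ 2 * m ^ 3 - 6 * X ^ 2 * m ^ 2 - X * m ^ 8 + 5 * X * m ^ 7 - 10 * X * m
        ^ 6 + 16 * X * m ^ 5 - 12 * X * m ^ 4 - X * m ^ 3 - 15 * X * m ^ 2 - 6 * X * m - m ^ 7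
        + 3 * m ^ 6 - 4 * m ^ 5 + 8 * m ^ 4 + 3 * m ^ 3 + 6 * m ^ 2 + 1 := by
    rw [b₂, tateCurve, hc, hb]
    linear_combination
      (X * m ^ 5 + 2 * X * m ^ 4 + X * m ^ 3 + m ^ 6 + m ^ 5 + 4 * m ^ 4 + 5 * m ^ 3 + m ^ 2) *
        h
  have hb₄ : (tateCurve r s).b₄ =
      X ^ 2 * m ^ 12 + 8 * X ^ 2 * m ^ 10 + 5 * X ^ 2 * m ^ 9 + 21 * X ^ 2 * m ^ 8 + 19 * X ^ 2
        * m ^ 7 + 23 * X ^ 2 * m ^ 6 + 12 * X ^ 2 * m ^ 5 + 4 * X ^ 2 * m ^ 4 - 2 * X ^ 2 * m ^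
        3 - X ^ 2 * m ^ 2 - X * m ^ 12 + 2 * X * m ^ 11 - 7 * X * m ^ 10 + 10 * X * m ^ 9 - 6 *
        X * m ^ 8 + 20 * X * m ^ 7 + 16 * X * m ^ 6 + 26 * X * m ^ 5 + 11 * X * m ^ 4 + 4 * X *
        m ^ 3 - 2 * X * m ^ 2 - X * m - m ^ 11 - 7 * m ^ 9 - 4 * m ^ 8 - 15 * m ^ 7 - 11 * m ^
        6 - 11 * m ^ 5 - 2 * m ^ 4 + m ^ 2 := by
    rw [b₄, tateCurve, hc, hb]
    linear_combination
      (X * m ^ 9 + X * m ^ 8 + 4 * X * m ^ 7 + 6 * X * m ^ 6 + 5 * X * m ^ 5 + 4 * X * m ^ 4 +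
        X * m ^ 3 + m ^ 10 + 7 * m ^ 8 + 5 * m ^ 7 + 15 * m ^ 6 + 15 * m ^ 5 + 12 * m ^ 4 + 6 *
        m ^ 3 + m ^ 2) * h
  have hb₆ : (tateCurve r s).b₆ =
      X ^ 2 * m ^ 16 - X ^ 2 * m ^ 15 + 12 * X ^ 2 * m ^ 14 - 3 * X ^ 2 * m ^ 13 + 49 * X ^ 2 *
        m ^ 12 + 18 * X ^ 2 * m ^ 11 + 95 * X ^ 2 * m ^ 10 + 74 * X ^ 2 * m ^ 9 + 102 * X ^ 2 *
        m ^ 8 + 79 * X ^ 2 * m ^ 7 + 52 * X ^ 2 * m ^ 6 + 24 * X ^ 2 * m ^ 5 + 7 * X ^ 2 * m ^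
        4 + X ^ 2 * m ^ 3 - X * m ^ 16 + 3 * X * m ^ 15 - 13 * X * m ^ 14 + 25 * X * m ^ 13 -
        45 * X * m ^ 12 + 68 * X * m ^ 11 - 34 * X * m ^ 10 + 94 * X * m ^ 9 + 53 * X * m ^ 8 +
        97 * X * m ^ 7 + 78 * X * m ^ 6 + 52 * X * m ^ 5 + 24 * X * m ^ 4 + 7 * X * m ^ 3 + X *
        m ^ 2 - m ^ 15 + m ^ 14 - 11 * m ^ 13 + 3 * m ^ 12 - 40 * m ^ 11 - 12 * m ^ 10 - 66 * m
        ^ 9 - 43 * m ^ 8 - 55 * m ^ 7 - 34 * m ^ 6 - 18 * m ^ 5 - 6 * m ^ 4 - m ^ 3 := by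
    rw [b₆, tateCurve, hb]
    linear_combination
      (X * m ^ 13 + 8 * X * m ^ 11 + 4 * X * m ^ 10 + 22 * X * m ^ 9 + 18 * X * m ^ 8 + 28 * X
        * m ^ 7 + 20 * X * m ^ 6 + 13 * X * m ^ 5 + 6 * X * m ^ 4 + X * m ^ 3 + m ^ 14 - m ^ 13
        + 11 * m ^ 12 - 2 * m ^ 11 + 40 * m ^ 10 + 18 * m ^ 9 + 68 * m ^ 8 + 54 * m ^ 7 + 61 *
        m ^ 6 + 41 * m ^ 5 + 20 * m ^ 4 + 7 * m ^ 3 + m ^ 2) * h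
  have hv : (r + m * X) ^ 2 =
      X ^ 2 * m ^ 6 - X ^ 2 * m ^ 5 + 6 * X ^ 2 * m ^ 4 - X ^ 2 * m ^ 3 + 6 * X ^ 2 * m ^ 2 - X
        * m ^ 6 + 3 * X * m ^ 5 - 7 * X * m ^ 4 + 11 * X * m ^ 3 - 3 * X * m ^ 2 + 6 * X * m -
        m ^ 5 + m ^ 4 - 5 * m ^ 3 + m ^ 2 - 2 * m + 1 := by
    rw [hr]
    linear_combination
      (X * m ^ 3 + m ^ 4 - m ^ 3 + 5 * m ^ 2) * h
  constructor
  · have : (r + m * X) ^ 4 = ((r + m * X) ^ 2) ^ 2 := by ring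
    rw [c₄, this, hv, hb₂, hb₄]
    linear_combination
      (24 * X * m ^ 13 + 216 * X * m ^ 11 + 144 * X * m ^ 10 + 648 * X * m ^ 9 + 720 * X * m ^
        8 + 840 * X * m ^ 7 + 672 * X * m ^ 6 + 264 * X * m ^ 5 + 24 * X * m ^ 4 + 24 * m ^ 14
        - 24 * m ^ 13 + 288 * m ^ 12 - 24 * m ^ 11 + 1128 * m ^ 10 + 720 * m ^ 9 + 2112 * m ^ 8
        + 1992 * m ^ 7 + 2016 * m ^ 6 + 1080 * m ^ 5 + 408 * m ^ 4 + 72 * m ^ 3) * h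
  · have : (r + m * X) ^ 6 = ((r + m * X) ^ 2) ^ 3 := by ring
    rw [c₆, this, hv, hb₂, hb₄, hb₆]
    linear_combination
      (-36 * X ^ 3 * m ^ 25 + 144 * X ^ 3 * m ^ 24 - 792 * X ^ 3 * m ^ 23 + 2124 * X ^ 3 * m ^
        22 - 5436 * X ^ 3 * m ^ 21 + 11520 * X ^ 3 * m ^ 20 - 12852 * X ^ 3 * m ^ 19 + 32940 *
        X ^ 3 * m ^ 18 + 8424 * X ^ 3 * m ^ 17 + 73620 * X ^ 3 * m ^ 16 + 101484 * X ^ 3 * m ^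
        15 + 154116 * X ^ 3 * m ^ 14 + 221292 * X ^ 3 * m ^ 13 + 218160 * X ^ 3 * m ^ 12 +
        215640 * X ^ 3 * m ^ 11 + 151056 * X ^ 3 * m ^ 10 + 90072 * X ^ 3 * m ^ 9 + 41328 * X ^
        3 * m ^ 8 + 13860 * X ^ 3 * m ^ 7 + 3456 * X ^ 3 * m ^ 6 + 432 * X ^ 3 * m ^ 5 - 36 * X
        ^ 2 * m ^ 26 + 216 * X ^ 2 * m ^ 25 - 1260 * X ^ 2 * m ^ 24 + 4320 * X ^ 2 * m ^ 23 -
        13140 * X ^ 2 * m ^ 22 + 30744 * X ^ 2 * m ^ 21 - 56628 * X ^ 2 * m ^ 20 + 102780 * X ^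
        2 * m ^ 19 - 94176 * X ^ 2 * m ^ 18 + 196056 * X ^ 2 * m ^ 17 + 43812 * X ^ 2 * m ^ 16
        + 329184 * X ^ 2 * m ^ 15 + 437796 * X ^ 2 * m ^ 14 + 604836 * X ^ 2 * m ^ 13 + 813600
        * X ^ 2 * m ^ 12 + 764136 * X ^ 2 * m ^ 11 + 688644 * X ^ 2 * m ^ 10 + 449460 * X ^ 2 *
        m ^ 9 + 244404 * X ^ 2 * m ^ 8 + 102924 * X ^ 2 * m ^ 7 + 31752 * X ^ 2 * m ^ 6 + 7344
        * X ^ 2 * m ^ 5 + 864 * X ^ 2 * m ^ 4 + 36 * X * m ^ 26 - 252 * X * m ^ 25 + 1404 * X *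
        m ^ 24 - 5292 * X * m ^ 23 + 15768 * X * m ^ 22 - 38952 * X * m ^ 21 + 74016 * X * m ^
        20 - 126756 * X * m ^ 19 + 156276 * X * m ^ 18 - 175788 * X * m ^ 17 + 146484 * X * m ^
        16 - 15912 * X * m ^ 15 + 146340 * X * m ^ 14 + 335556 * X * m ^ 13 + 413352 * X * m ^
        12 + 689580 * X * m ^ 11 + 652536 * X * m ^ 10 + 595008 * X * m ^ 9 + 385884 * X * m ^
        8 + 203868 * X * m ^ 7 + 83844 * X * m ^ 6 + 24948 * X * m ^ 5 + 5580 * X * m ^ 4 + 648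
        * X * m ^ 3 + 36 * m ^ 25 - 180 * m ^ 24 + 1008 * m ^ 23 - 2916 * m ^ 22 + 8136 * m ^
        21 - 14508 * m ^ 20 + 21564 * m ^ 19 - 17532 * m ^ 18 - 7452 * m ^ 17 + 48132 * m ^ 16
        - 102096 * m ^ 15 + 148320 * m ^ 14 - 86688 * m ^ 13 + 207360 * m ^ 12 + 113220 * m ^
        11 + 284508 * m ^ 10 + 260352 * m ^ 9 + 233496 * m ^ 8 + 149688 * m ^ 7 + 75240 * m ^ 6
        + 30060 * m ^ 5 + 8568 * m ^ 4 + 1836 * m ^ 3 + 216 * m ^ 2) * h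

/-- With v = r + mX and G the quartic in `hG`, the invariants c₄ and c₆ of the two curves differ by
(v/G)⁴ and (v/G)⁶. Hence u = v/G works in `F` itself, with no quadratic twist left over. -/
lemma exists_smul_tateCurve_eq [CharZero F]
    (h : m * X ^ 3 - (m ^ 2 + m - 1) * X ^ 2 + (m ^ 2 - 2 * m - 1) * X + m = 0)
    (hr : r = m ^ 2 * X ^ 2 - (m ^ 2 - 2 * m) * X - (m - 1))
    (hs : s = m * X ^ 2 - (m ^ 2 - 1) * X - m)
    (hG : m ^ 4 - m ^ 3 + 5 * m ^ 2 + m + 1 ≠ 0) (hv : r + m * X ≠ 0) :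
    ∃ C : VariableChange F, C • tateCurve r s = thirteenCurve m := by
  obtain ⟨h₄, h₆⟩ := tateCurve_c₄_c₆ h hr hs
  obtain ⟨C, hC⟩ := exists_smul_eq_short (tateCurve r s) (div_ne_zero hv hG)
  refine ⟨C, hC.trans ?_⟩
  rw [mul_comm, ← eq_div_iff hG] at h₄
  rw [mul_comm, ← eq_div_iff (pow_ne_zero 2 hG)] at h₆
  rw [h₄, h₆, thirteenCurve]
  generalize r + m * X = v at hv
  generalize m ^ 4 - m ^ 3 + 5 * m ^ 2 + m + 1 = G at hG
  ext
  any_goals rfl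
  all_goals
    dsimp only
    field_simp

end Parametrization

end WeierstrassCurve

/-! ### The cubic field and its point of order 13. -/

section CubicField

open Polynomial

/-- The cubic polynomial defining the field of definition of the points of order `13`. -/
noncomputable def thirteenCubic (m : ℤ) : ℚ[X] :=
  C (m : ℚ) * X ^ 3 + C (-((m : ℚ) ^ 2 + m - 1)) * X ^ 2 + C ((m : ℚ) ^ 2 - 2 * m - 1) * X +
    C (m : ℚ)

lemma thirteenCubic_natDegree {m : ℤ} (hm : m ≠ 0) : (thirteenCubic m).natDegree = 3 :=
  natDegree_cubic (Int.cast_ne_zero.2 hm)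

lemma thirteenCubic_eval₂ {K : Type*} [Field K] (f : ℚ →+* K) (m : ℤ) (x : K) :
    (thirteenCubic m).eval₂ f x =
      (m : K) * x ^ 3 - (m ^ 2 + m - 1) * x ^ 2 + (m ^ 2 - 2 * m - 1) * x + m := by
  simp only [thirteenCubic, eval₂_add, eval₂_mul, eval₂_C, eval₂_X, eval₂_X_pow]
  simp only [map_add, map_sub, map_neg, map_mul, map_pow, map_one, map_ofNat, map_intCast]
  ring

/-- For odd `m` the form reduces mod 2 to p³ + p²q + q³, which has no nontrivial zero over 𝔽₂; the
Bézout relation excludes p = q = 0. -/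
lemma cubic_form_ne_zero_of_odd {m p q : ℤ} (hm : Odd m) (hpq : IsCoprime p q) :
    m * p ^ 3 - (m ^ 2 + m - 1) * p ^ 2 * q + (m ^ 2 - 2 * m - 1) * p * q ^ 2 + m * q ^ 3 ≠ 0 := by
  intro h
  obtain ⟨k, rfl⟩ := hm
  obtain ⟨a, b, hab⟩ := hpq
  have h2 := congr_arg (Int.cast : ℤ → ZMod 2) h
  have hab2 := congr_arg (Int.cast : ℤ → ZMod 2) hab
  push_cast at h2 hab2
  generalize (k : ZMod 2) = k at h2
  generalize (p : ZMod 2) = p at h2 hab2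
  generalize (q : ZMod 2) = q at h2 hab2
  generalize (a : ZMod 2) = a at hab2
  generalize (b : ZMod 2) = b at hab2
  revert k p q a b
  decide

lemma thirteenCubic_irreducible {m : ℤ} (hm : Odd m) : Irreducible (thirteenCubic m) := by
  have hm₀ : m ≠ 0 := by rintro rfl; simp at hm
  have hdeg := thirteenCubic_natDegree hm₀
  refine irreducible_of_degree_le_three_of_not_isRoot (by simp [hdeg]) fun x hx ↦ ?_
  refine cubic_form_ne_zero_of_odd (p := x.num) (q := x.den) hm x.isCoprime_num_den ?_
  have hd : (x.den : ℚ) ≠ 0 := by exact_mod_cast x.den_nz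
  rw [IsRoot.def, thirteenCubic] at hx
  simp only [eval_add, eval_mul, eval_C, eval_pow, eval_X] at hx
  rw [← Rat.num_div_den x] at hx
  field_simp at hx
  rw [← @Int.cast_inj ℚ]
  push_cast
  linear_combination hx

open WeierstrassCurve in
lemma thirteenCurve_isElliptic (K : Type*) [Field K] [CharZero K] {m : ℤ} (hm : 5 ≤ m) :
    (thirteenCurve (m : K)).IsElliptic := by
  rw [isElliptic_iff, thirteenCurve_Δ, isUnit_iff_ne_zero]
  have h₁ : m ^ 4 - m ^ 3 + 5 * m ^ 2 + m + 1 ≠ 0 := by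
    nlinarith [pow_pos (by linarith : 0 < m) 3]
  have h₂ : m ^ 2 - 3 * m - 1 ≠ 0 := by nlinarith
  have h₃ : m ≠ 0 := by lia
  exact_mod_cast mul_ne_zero (mul_ne_zero (pow_ne_zero 8 h₁) (pow_ne_zero 13 h₃)) h₂

open WeierstrassCurve in
/-- A root of the cubic that satisfies no quadratic equation gives a point of order `13`. -/
lemma exists_addOrderOf_eq_thirteen {K : Type*} [Field K] [CharZero K] [DecidableEq K] {m : ℤ}
    (hm : 5 ≤ m) {x : K}
    (h : (m : K) * x ^ 3 - (m ^ 2 + m - 1) * x ^ 2 + (m ^ 2 - 2 * m - 1) * x + m = 0)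
    (hquad : ∀ a b c : ℤ, a ≠ 0 → (a : K) * x ^ 2 + b * x + c ≠ 0) :
    ∃ P : (thirteenCurve (m : K)).toAffine.Point, addOrderOf P = 13 := by
  obtain ⟨r, hr⟩ : ∃ r, r = (m : K) ^ 2 * x ^ 2 - (m ^ 2 - 2 * m) * x - (m - 1) := ⟨_, rfl⟩
  obtain ⟨s, hs⟩ : ∃ s, s = (m : K) * x ^ 2 - (m ^ 2 - 1) * x - m := ⟨_, rfl⟩
  -- Every quantity that must not vanish is a quadratic in `x` with nonzero leading coefficient.
  have ne_zero (a b c : ℤ) (ha : a ≠ 0) {y : K} (hy : y = a * x ^ 2 + b * x + c) : y ≠ 0 :=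
    hy ▸ hquad a b c ha
  have hm₀ : m ≠ 0 := by lia
  have hm₂ : m ^ 2 ≠ 0 := pow_ne_zero 2 hm₀
  have hr₀ : r ≠ 0 :=
    ne_zero (m ^ 2) (-(m ^ 2 - 2 * m)) (-(m - 1)) hm₂ (by push_cast; rw [hr]; ring)
  have hr₁ : r - 1 ≠ 0 :=
    ne_zero (m ^ 2) (-(m ^ 2 - 2 * m)) (-m) hm₂ (by push_cast; rw [hr]; ring)
  have hs₀ : s ≠ 0 := ne_zero m (-(m ^ 2 - 1)) (-m) hm₀ (by push_cast; rw [hs]; ring)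
  have hs₁ : s - 1 ≠ 0 := ne_zero m (-(m ^ 2 - 1)) (-m - 1) hm₀ (by push_cast; rw [hs]; ring)
  have hrs : r - s ≠ 0 :=
    ne_zero (m * (m - 1)) (2 * m - 1) 1 (mul_ne_zero hm₀ (by lia))
      (by push_cast; rw [hr, hs]; ring)
  have hv : r + m * x ≠ 0 :=
    ne_zero (m ^ 2) (-(m ^ 2 - 3 * m)) (-(m - 1)) hm₂ (by push_cast; rw [hr]; ring)
  have hG : (m : K) ^ 4 - m ^ 3 + 5 * m ^ 2 + m + 1 ≠ 0 := by
    have : m ^ 4 - m ^ 3 + 5 * m ^ 2 + m + 1 ≠ 0 := by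
      nlinarith [pow_pos (by linarith : (0 : ℤ) < m) 3]
    exact_mod_cast this
  obtain ⟨C, hC⟩ := exists_smul_tateCurve_eq h hr hs hG hv
  have hell := thirteenCurve_isElliptic K hm
  rw [← hC] at hell ⊢
  have : (tateCurve r s).IsElliptic := by
    rw [← inv_smul_smul C (tateCurve r s)]
    infer_instance
  have h₀ : (tateCurve r s).toAffine.Nonsingular 0 0 :=
    Affine.equation_iff_nonsingular.1 (by simp [Affine.equation_iff, tateCurve])
  have : Fact (Nat.Prime 13) := ⟨by norm_num⟩
  refine ⟨Affine.Point.variableChange C (.some 0 0 h₀), addOrderOf_eq_prime ?_ ?_⟩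
  · rw [← map_nsmul, Affine.thirteen_nsmul_eq_zero_of_tateCurve hr₀ hs₀ hr₁ hs₁ hrs
      (thirteen_relation h hr hs) rfl, map_zero]
  · exact Affine.Point.variableChange_some_ne_zero C h₀

open WeierstrassCurve Classical in
lemma thirteenCurve_hasPointOfOrder {m : ℤ} (hm : 5 ≤ m) (hodd : Odd m) :
    HasPointOfOrderOverCubicField (thirteenCurve (m : ℚ)) 13 := by
  have hm₀ : m ≠ 0 := by lia
  have hirr := thirteenCubic_irreducible hodd
  have : Fact (Irreducible (thirteenCubic m)) := ⟨hirr⟩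
  have hrank : Module.finrank ℚ (AdjoinRoot (thirteenCubic m)) = 3 := by
    rw [(AdjoinRoot.powerBasis hirr.ne_zero).finrank, AdjoinRoot.powerBasis_dim,
      thirteenCubic_natDegree hm₀]
  have : FiniteDimensional ℚ (AdjoinRoot (thirteenCubic m)) :=
    Module.finite_of_finrank_pos (by lia)
  have : NumberField (AdjoinRoot (thirteenCubic m)) := { }
  refine ⟨AdjoinRoot (thirteenCubic m), inferInstance, inferInstance, hrank, ?_⟩
  have hmap : ((thirteenCurve (m : ℚ)).baseChange (AdjoinRoot (thirteenCubic m))) =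
      thirteenCurve (m : AdjoinRoot (thirteenCubic m)) := by
    rw [baseChange, thirteenCurve_map, map_intCast]
  rw [hmap]
  refine exists_addOrderOf_eq_thirteen hm (x := AdjoinRoot.root (thirteenCubic m)) ?_ ?_
  · rw [← thirteenCubic_eval₂ (AdjoinRoot.of (thirteenCubic m)), AdjoinRoot.eval₂_root]
  · intro a b c ha h
    have hg : (C (a : ℚ) * X ^ 2 + C (b : ℚ) * X + C (c : ℚ)).natDegree = 2 :=
      natDegree_quadratic (Int.cast_ne_zero.2 ha)
    have hdvd : thirteenCubic m ∣ C (a : ℚ) * X ^ 2 + C (b : ℚ) * X + C (c : ℚ) := by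
      rw [← AdjoinRoot.mk_eq_zero, ← AdjoinRoot.aeval_eq]
      simpa using h
    have := natDegree_le_of_dvd hdvd (ne_zero_of_natDegree_gt (n := 0) (by lia))
    rw [thirteenCubic_natDegree hm₀] at this
    lia

end CubicField

/-! ### Unboundedness of the j-invariant. -/

open WeierstrassCurve in
/-- The `j`-invariant on isomorphism classes of Weierstrass curves, with junk value `0` on singular
ones. -/
def RatIsomClass.j : RatIsomClass → ℚ :=
  Quotient.lift (fun E : WeierstrassCurve ℚ ↦ E.c₄ ^ 3 / E.Δ) <| by
    rintro _ E ⟨C, rfl⟩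
    have hu : (C.u : ℚ) ≠ 0 := C.u.ne_zero
    simp only [variableChange_c₄, variableChange_Δ, Units.val_inv_eq_inv_val]
    rw [mul_pow, ← pow_mul, mul_div_mul_left _ _ (pow_ne_zero _ (inv_ne_zero hu))]

open WeierstrassCurve in
lemma le_j_thirteenCurve {m : ℚ} (hm : 5 ≤ m) :
    m - 4 ≤ RatIsomClass.j (ratIsomClass (thirteenCurve m)) := by
  change _ ≤ (thirteenCurve m).c₄ ^ 3 / (thirteenCurve m).Δ
  rw [thirteenCurve_c₄, thirteenCurve_Δ]
  have hm₀ : 0 < m := by linarith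
  -- t = T/m = m - 3 - 1/m is a coordinate on X₀(13), with j = (t² + 5t + 13)(t⁴ + 7t³ + 20t² + 19t
  -- + 1)³/t. Homogenized in `T` and `m`, the factors have positive coefficients, so dropping terms
  -- bounds j below.
  obtain ⟨T, hT⟩ : ∃ T, T = m ^ 2 - 3 * m - 1 := ⟨_, rfl⟩
  obtain ⟨G, hG⟩ : ∃ G, G = m ^ 4 - m ^ 3 + 5 * m ^ 2 + m + 1 := ⟨_, rfl⟩
  obtain ⟨Q, hQ⟩ : ∃ Q, Q = m ^ 8 - 5 * m ^ 7 + 7 * m ^ 6 - 5 * m ^ 5 + 5 * m ^ 3 + 7 * m ^ 2 +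
    5 * m + 1 := ⟨_, rfl⟩
  have hT₀ : 0 < T := by rw [hT]; nlinarith
  have hTm : (m - 4) * m ≤ T := by rw [hT]; linarith
  have hTG : T ^ 2 ≤ G := by
    have : G = T ^ 2 + 5 * T * m + 13 * m ^ 2 := by rw [hT, hG]; ring
    rw [this, add_assoc]
    exact le_add_of_nonneg_right (by positivity)
  have hmQ : m ^ 4 ≤ Q := by
    have : Q = m ^ 4 + (T ^ 4 + 7 * T ^ 3 * m + 20 * T ^ 2 * m ^ 2 + 19 * T * m ^ 3) := by
      rw [hT, hQ]; ring
    rw [this]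
    exact le_add_of_nonneg_right (by positivity)
  have hG₀ : 0 < G := lt_of_lt_of_le (by positivity) hTG
  rw [← hT, ← hG, ← hQ, le_div_iff₀ (by positivity)]
  calc (m - 4) * (G ^ 8 * m ^ 13 * T) = G ^ 8 * m ^ 12 * T * ((m - 4) * m) := by ring
    _ ≤ G ^ 8 * m ^ 12 * T * T := by gcongr
    _ = G ^ 8 * (T ^ 2 * (m ^ 4) ^ 3) := by ring
    _ ≤ G ^ 8 * (G * Q ^ 3) := by gcongr
    _ = (G ^ 3 * Q) ^ 3 := by ring

theorem mainTheorem5 :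
    {c : RatIsomClass | ∃ E : WeierstrassCurve ℚ, E.IsElliptic ∧ ratIsomClass E = c ∧
      HasPointOfOrderOverCubicField E 13}.Infinite := by
  intro hfin
  obtain ⟨B, hB⟩ := (hfin.image RatIsomClass.j).bddAbove
  obtain ⟨k, hk⟩ := exists_nat_gt B
  -- m = 2k + 5 is odd and m - 4 = 2k + 1 exceeds `B`.
  have hm : (5 : ℤ) ≤ 2 * k + 5 := by lia
  have hj := hB ⟨_, ⟨_, thirteenCurve_isElliptic ℚ hm, rfl,
    thirteenCurve_hasPointOfOrder hm ⟨k + 2, by ring⟩⟩, rfl⟩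
  have := (le_j_thirteenCurve (m := ((2 * k + 5 : ℤ) : ℚ)) (by exact_mod_cast hm)).trans hj
  push_cast at this
  have hk₀ : (0 : ℚ) ≤ k := k.cast_nonneg
  linarith
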